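/- Let $\alpha,\beta\ge 0$ with $\alpha+\beta>0$ and let $\lambda_1>0$. There is a constant $C=C(\alpha,\beta,\lambda_1)>0$ such that the following holds. Let $\Omega\subset\mathbb R^d$ be a bounded domain and let $A=-\Delta$ be the Dirichlet Laplacian on $L^2(\Omega)$, i.e. the positive self-adjoint operator associated with the form $a(v,w)=\int_\Omega\nabla v\cdot\nabla w$ on $H^1_0(\Omega)$ (with domain $H^2(\Omega)\cap H^1_0(\Omega)$ if $\partial\Omega$ is regular). Assume that $\lambda_1$ is the smallest positive eigenvalue of $A$. For real $r\ge 0$ put $|v|_r^2=\|A^{r/2}v\|^2=\sum_\mu \mu^{r}\|P_\mu v\|^2$, where $\mu$ runs over the eigenvalues of $A$ and $P_\mu$ is the orthogonal projection onto the eigenspace of $\mu$, with $|v|_r=\infty$ if $v\notin D(A^{r/2})$. Let $j\ge\frac12$ be real, $u_0\in D(A^{j})$, $u_1\in D(A^{j-1/2})$, and let $u\in C^1([0,\infty);L^2(\Omega))\cap C([0,\infty);H^1_0(\Omega))$ be a solution of the variational form of $$u''+\beta Au'+\alpha u'+Au=0\quad(t\ge 0),\qquad u=0\ \text{on }\partial\Omega,\qquad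 u(0)=u_0,\quad u'(0)=u_1,$$ that is, $\frac{d}{dt}\big[(u',v)+\beta a(u,v)\big]+\alpha(u',v)+a(u,v)=0$ for all $v\in H^1_0(\Omega)$ and $t\ge0$. Let $k\ge 1$ be an integer for which the time derivative $u^{(k)}$ exists, i.e. $u\in C^k([0,\infty);L^2(\Omega))$, and set $$E^{(k)}_{A^{(j)}}(u)(t)=\tfrac12\Big(|u^{(k)}(t)|_{2j-1}^2+|u^{(k-1)}(t)|_{2j}^2\Big)\in[0,\infty].$$ Let $0<\delta\le\min\left(\frac{\alpha+\beta\lambda_1}{2},\frac{\lambda_1}{\alpha+\beta\lambda_1}\right)$. Then: (i) if $\delta<\min\left(\frac{\alpha+\beta\lambda_1}{2},\frac{\lambda_1}{\alpha+\beta\lambda_1}\right)$ or $\delta=\frac{\alpha+\beta\lambda_1}{2}$, then for all $t\ge 0$ $$E^{(k)}_{A^{(j)}}(u)(t)\le C\,e^{-2\delta t}\,E^{(k)}_{A^{(j)}}(u)(0);$$ (ii) if $\delta=\frac{\lambda_1}{\alpha+\beta\lambda_1}$, then for all $t\ge 0$ $$|u^{(k)}(t)|_{2j-1}^2\le C\,e^{-2\delta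 t}\,E^{(k)}_{A^{(j)}}(u)(0).$$ -/

import Mathlib

open MeasureTheory Set
open scoped ENNReal

noncomputable section

namespace DampedWave

/-- The real space `L²(Ω)`, `Ω ⊆ ℝ^d`. -/
abbrev L2 {d : ℕ} (Ω : Set (EuclideanSpace ℝ (Fin d))) : Type :=
  Lp ℝ 2 ((volume : Measure (EuclideanSpace ℝ (Fin d))).restrict Ω)

/-- The space `L²(Ω; ℝ^d)` of square integrable vector fields. -/
abbrev L2Vec {d : ℕ} (Ω : Set (EuclideanSpace ℝ (Fin d))) : Type :=
  Lp (EuclideanSpace ℝ (Fin d)) 2 ((volume : Measure (EuclideanSpace ℝ (Fin d))).restrict Ω)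

/-- The pairs `(φ, ∇φ)` with `φ ∈ C_c^∞(Ω)`, as elements of `L²(Ω) × L²(Ω; ℝ^d)`. -/
def testPairs {d : ℕ} (Ω : Set (EuclideanSpace ℝ (Fin d))) : Set (L2 Ω × L2Vec Ω) :=
  {p | ∃ φ : EuclideanSpace ℝ (Fin d) → ℝ, ContDiff ℝ (⊤ : ℕ∞) φ ∧ HasCompactSupport φ ∧
    tsupport φ ⊆ Ω ∧ p.1 =ᵐ[volume.restrict Ω] φ ∧ p.2 =ᵐ[volume.restrict Ω] gradient φ}

/-- The space `H¹₀(Ω)`, the closure of `C_c^∞(Ω)` in the `H¹`-norm. An element `v` is recorded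
together with its weak gradient, as the pair `(v, ∇v)`; the topology of the product
`L²(Ω) × L²(Ω; ℝ^d)` on such pairs is that of the `H¹`-norm. (The test pairs already form a linear
space, so that taking the span only serves to obtain a `Submodule`.) -/
def H10 {d : ℕ} (Ω : Set (EuclideanSpace ℝ (Fin d))) : Submodule ℝ (L2 Ω × L2Vec Ω) :=
  (Submodule.span ℝ (testPairs Ω)).topologicalClosure

/-- `u ∈ D(A)` and `A u = f`, where `A = -Δ` is the Dirichlet Laplacian, the positive self-adjoint
operator on `L²(Ω)` given by the form `a(u, v) = ∫ ∇u · ∇v` on `H¹₀(Ω)`: `u ∈ H¹₀(Ω)` and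
`a(u, v) = (f, v)` for all `v ∈ H¹₀(Ω)`. Its domain is `H²(Ω) ∩ H¹₀(Ω)` when the boundary of `Ω`
is regular enough for `-Δ` to be self-adjoint on that space. -/
def IsDirichletLaplacian {d : ℕ} (Ω : Set (EuclideanSpace ℝ (Fin d))) (u f : L2 Ω) : Prop :=
  ∃ g : L2Vec Ω, (u, g) ∈ H10 Ω ∧ ∀ p ∈ H10 Ω, inner ℝ g p.2 = inner ℝ f p.1

/-- The eigenspace `{u ∈ D(A) : A u = μ u}`. -/
def eigenspace {d : ℕ} (Ω : Set (EuclideanSpace ℝ (Fin d))) (μ : ℝ) : Submodule ℝ (L2 Ω) where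
  carrier := {u | IsDirichletLaplacian Ω u (μ • u)}
  zero_mem' := ⟨0, (H10 Ω).zero_mem, fun p _ => by simp⟩
  add_mem' := by
    rintro u v ⟨g, hg, hg'⟩ ⟨h, hh, hh'⟩
    refine ⟨g + h, (H10 Ω).add_mem hg hh, fun p hp => ?_⟩
    rw [inner_add_left, hg' p hp, hh' p hp, smul_add, inner_add_left]
  smul_mem' := by
    rintro c u ⟨g, hg, hg'⟩
    refine ⟨c • g, (H10 Ω).smul_mem c hg, fun p hp => ?_⟩
    rw [real_inner_smul_left, hg' p hp, ← real_inner_smul_left, smul_comm]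

/-- The graph of the gradient on an eigenspace. -/
def eigenGraph {d : ℕ} (Ω : Set (EuclideanSpace ℝ (Fin d))) (μ : ℝ) : Set (L2 Ω × L2Vec Ω) :=
  {q | q ∈ H10 Ω ∧ ∀ p ∈ H10 Ω, inner ℝ q.2 p.2 = inner ℝ (μ • q.1) p.1}

theorem isClosed_eigenGraph {d : ℕ} (Ω : Set (EuclideanSpace ℝ (Fin d))) (μ : ℝ) :
    IsClosed (eigenGraph Ω μ) := by
  have h1 : IsClosed {q : L2 Ω × L2Vec Ω | q ∈ H10 Ω} :=
    Submodule.isClosed_topologicalClosure _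
  have h2 : IsClosed {q : L2 Ω × L2Vec Ω |
      ∀ p ∈ H10 Ω, inner ℝ q.2 p.2 = inner ℝ (μ • q.1) p.1} := by
    simp only [ofPred_forall]
    refine isClosed_iInter fun p => isClosed_iInter fun _ => isClosed_eq ?_ ?_ <;> fun_prop
  exact h1.inter h2

theorem isClosed_eigenspace {d : ℕ} (Ω : Set (EuclideanSpace ℝ (Fin d))) (μ : ℝ) :
    IsClosed (eigenspace Ω μ : Set (L2 Ω)) := by
  have hc : CompleteSpace (eigenGraph Ω μ) := (isClosed_eigenGraph Ω μ).completeSpace_coe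
  have hsub : ∀ q ∈ eigenGraph Ω μ, ∀ r ∈ eigenGraph Ω μ, q - r ∈ eigenGraph Ω μ := by
    rintro q ⟨hq, hq'⟩ r ⟨hr, hr'⟩
    refine ⟨(H10 Ω).sub_mem hq hr, fun p hp => ?_⟩
    rw [Prod.snd_sub, Prod.fst_sub, inner_sub_left, hq' p hp, hr' p hp, smul_sub, inner_sub_left]
  have hbd : ∀ q ∈ eigenGraph Ω μ, ‖q‖ ≤ (1 + |μ|) * ‖q.1‖ := by
    rintro q ⟨hq, hq'⟩
    have h := hq' q hq
    rw [real_inner_smul_left, real_inner_self_eq_norm_sq, real_inner_self_eq_norm_sq] at h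
    have h3 : ‖q.2‖ ≤ (1 + |μ|) * ‖q.1‖ := by
      refine abs_le_of_sq_le_sq' ?_ (by positivity) |>.2
      have := le_abs_self μ
      have := abs_nonneg μ
      rw [h, mul_pow]
      gcongr
      nlinarith
    rw [Prod.norm_def]
    refine max_le ?_ h3
    have := mul_nonneg (abs_nonneg μ) (norm_nonneg q.1)
    linarith
  have hanti : AntilipschitzWith (1 + ‖μ‖₊) (fun q : eigenGraph Ω μ => q.1.1) := by
    refine AntilipschitzWith.of_le_mul_dist fun q r => ?_
    have := hbd _ (hsub _ q.2 _ r.2)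
    rw [Subtype.dist_eq, dist_eq_norm, dist_eq_norm]
    simpa using this
  have hu : UniformContinuous (fun q : eigenGraph Ω μ => q.1.1) :=
    uniformContinuous_fst.comp uniformContinuous_subtype_val
  have hr := hanti.isClosed_range hu
  convert hr using 1
  ext u
  constructor
  · rintro ⟨g, hg, hg'⟩
    exact ⟨⟨(u, g), hg, hg'⟩, rfl⟩
  · rintro ⟨⟨⟨v, g⟩, hg, hg'⟩, rfl⟩
    exact ⟨g, hg, hg'⟩

instance {d : ℕ} (Ω : Set (EuclideanSpace ℝ (Fin d))) (μ : ℝ) :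
    CompleteSpace (eigenspace Ω μ) :=
  (isClosed_eigenspace Ω μ).completeSpace_coe

/-- The positive eigenvalues of the Dirichlet Laplacian `A` on `Ω`. -/
def eigenvalues {d : ℕ} (Ω : Set (EuclideanSpace ℝ (Fin d))) : Set ℝ :=
  {μ | 0 < μ ∧ eigenspace Ω μ ≠ ⊥}

/-- `|x|_r² = ‖A^{r/2} x‖² = ∑_μ μ^r ‖P_μ x‖² ∈ [0, ∞]`, the sum running over the eigenvalues `μ`
of `A`, with `P_μ` the orthogonal projection of `L²(Ω)` onto the eigenspace of `μ`. The value is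
`∞` exactly when `x` (in `L²(Ω)`) is not in the domain of `A^{r/2}` (`r ≥ 0`). -/
def normSq {d : ℕ} (Ω : Set (EuclideanSpace ℝ (Fin d))) (r : ℝ) (x : L2 Ω) : ℝ≥0∞ :=
  ∑' μ : eigenvalues Ω,
    ENNReal.ofReal ((μ : ℝ) ^ r * ‖(eigenspace Ω (μ : ℝ)).starProjection x‖ ^ 2)

/-- The domain `D(A^s)` of the fractional power `A^s`, `s ≥ 0`. -/
def domPow {d : ℕ} (Ω : Set (EuclideanSpace ℝ (Fin d))) (s : ℝ) : Set (L2 Ω) :=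
  {x | normSq Ω (2 * s) x < ⊤}

/-- The `m`-th time derivative `u^{(m)}(t)` of `u : [0, ∞) → L²(Ω)` (one-sided at `t = 0`). The
values of `u` at negative times play no role. -/
def timeDeriv {d : ℕ} {Ω : Set (EuclideanSpace ℝ (Fin d))} (m : ℕ) (u : ℝ → L2 Ω) (t : ℝ) : L2 Ω :=
  iteratedDerivWithin m u (Ici 0) t

/-- `u` is a solution on `[0, ∞)` of the variational form of
`u'' + β A u' + α u' + A u = 0`, `u = 0` on `∂Ω`, `u(0) = u₀`, `u'(0) = u₁`:
`u ∈ C¹([0, ∞); L²(Ω)) ∩ C([0, ∞); H¹₀(Ω))` and, for all `v ∈ H¹₀(Ω)` and `t ≥ 0`,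
`d/dt ((u', v) + β a(u, v)) + α (u', v) + a(u, v) = 0`.
This is `(u'', v) + β a(u', v) + α (u', v) + a(u, v) = 0` as soon as `u''` and `∇u'` make sense. -/
structure IsSolution {d : ℕ} (Ω : Set (EuclideanSpace ℝ (Fin d))) (α β : ℝ) (u₀ u₁ : L2 Ω)
    (u : ℝ → L2 Ω) : Prop where
  contDiffOn : ContDiffOn ℝ 1 u (Ici 0)
  initial : u 0 = u₀
  initial_deriv : timeDeriv 1 u 0 = u₁
  /-- `G t` is the gradient of `u t`. -/
  equation : ∃ G : ℝ → L2Vec Ω, ContinuousOn G (Ici 0) ∧ (∀ t, 0 ≤ t → (u t, G t) ∈ H10 Ω) ∧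
    ∀ p ∈ H10 Ω, ∀ t, 0 ≤ t →
      HasDerivWithinAt (fun s => inner ℝ (timeDeriv 1 u s) p.1 + β * inner ℝ (G s) p.2)
        (-(α * inner ℝ (timeDeriv 1 u t) p.1 + inner ℝ (G t) p.2)) (Ici 0) t

/-- The energy `½ (|u^{(k)}(t)|²_{2j-1} + |u^{(k-1)}(t)|²_{2j}) ∈ [0, ∞]`, for `k ≥ 1`. -/
def energy {d : ℕ} {Ω : Set (EuclideanSpace ℝ (Fin d))} (j : ℝ) (k : ℕ) (u : ℝ → L2 Ω) (t : ℝ) :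
    ℝ≥0∞ :=
  (normSq Ω (2 * j - 1) (timeDeriv k u t) + normSq Ω (2 * j) (timeDeriv (k - 1) u t)) / 2

end DampedWave

end

/-!
The squared norms `|·|_r²` are sums over the eigenvalues `μ` of the Dirichlet Laplacian, so it is
enough to bound each term with a constant that does not depend on `μ`. Testing the equation with
eigenfunctions shows that the projection `y = P_μ u^{(k-1)}` satisfies the damped oscillator equation
`y'' + b y' + μ y = 0` with `b = α + β μ`
(`DampedWave.IsSolution.hasDerivWithinAt_starProjection_succ`). The assumption on `δ` and the
minimality of `λ₁` give `δ ≤ b / 2` and `δ b ≤ μ` for every eigenvalue `μ`.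

For such `δ`, put `q = μ - b δ + δ² ≥ δ²`. Both of the functions
`exp (2 δ t) (‖y' + δ y‖² + q ‖y‖²)` and `exp (2 δ t) (‖y' + (b - δ) y‖² + q ‖y‖²)` are nonincreasing
(`Oscillator.antitoneOn_energy`). The first one controls `‖y'‖²`, and it controls `μ ‖y‖²` unless `q`
is much smaller than `μ`, which happens only under strong damping `b² ≫ μ`, `δ ≪ b`. In that case
the difference of the two vectors `y' + δ y` and `y' + (b - δ) y` is `(b - 2 δ) y`, with `b - 2 δ`
comparable to `b`, and the second function, taken with the weight `μ / b²`, controls `μ ‖y‖²`.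
In all cases `‖y'‖² + μ ‖y‖² ≤ 48 exp (-2 δ t) (‖y'(0)‖² + μ ‖y(0)‖²)` (`Oscillator.energy_le`), so
the estimate of the full energy holds on the whole range of `δ`, with a universal constant.
-/

/-! ### The damped oscillator in an inner product space -/

namespace Oscillator

variable {E : Type*} [NormedAddCommGroup E] [InnerProductSpace ℝ E]

/-- After the substitution `z = exp (δ t) y` the equation `y'' + b y' + μ y = 0` becomes
`z'' + p z' + q z = 0` with `p = b - 2 δ` and `q = μ - b δ + δ²`. The two functions considered here
are `‖z'‖² + q ‖z‖²`, for `c = δ`, with derivative `-2 p ‖z'‖²`, and `‖z' + p z‖² + q ‖z‖²`, for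
`c = b - δ`, with derivative `-2 p q ‖z‖²`. -/
theorem antitoneOn_energy {b μ δ c : ℝ} (hδb : 2 * δ ≤ b) (hq : 0 ≤ μ - b * δ + δ ^ 2)
    (hc : c = δ ∨ c = b - δ) {y y' : ℝ → E}
    (hy : ∀ t, 0 ≤ t → HasDerivWithinAt y (y' t) (Ici 0) t)
    (hy' : ∀ t, 0 ≤ t → HasDerivWithinAt y' (-(b • y' t + μ • y t)) (Ici 0) t) :
    AntitoneOn (fun t => Real.exp (2 * δ * t) *
      (‖y' t + c • y t‖ ^ 2 + (μ - b * δ + δ ^ 2) * ‖y t‖ ^ 2)) (Ici 0) := by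
  have hder : ∀ t, 0 ≤ t → HasDerivWithinAt (fun t => Real.exp (2 * δ * t) *
      (‖y' t + c • y t‖ ^ 2 + (μ - b * δ + δ ^ 2) * ‖y t‖ ^ 2))
      (Real.exp (2 * δ * t) * (2 * δ) *
          (‖y' t + c • y t‖ ^ 2 + (μ - b * δ + δ ^ 2) * ‖y t‖ ^ 2) +
        Real.exp (2 * δ * t) *
          (2 * inner ℝ (y' t + c • y t) (-(b • y' t + μ • y t) + c • y' t) +
            (μ - b * δ + δ ^ 2) * (2 * inner ℝ (y t) (y' t)))) (Ici 0) t := by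
    intro t ht
    have he : HasDerivWithinAt (fun t => Real.exp (2 * δ * t))
        (Real.exp (2 * δ * t) * (2 * δ)) (Ici 0) t := by
      simpa using (((hasDerivAt_id t).const_mul (2 * δ)).exp).hasDerivWithinAt
    exact he.mul ((((hy' t ht).add ((hy t ht).const_smul c)).norm_sq).add
      (((hy t ht).norm_sq).const_mul _))
  refine antitoneOn_of_hasDerivWithinAt_nonpos (convex_Ici 0)
    (fun t ht => (hder t ht).continuousWithinAt)
    (fun t ht => (hder t (interior_subset ht)).mono interior_subset) fun t _ => ?_
  rw [mul_assoc, ← mul_add]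
  refine mul_nonpos_of_nonneg_of_nonpos (Real.exp_pos _).le ?_
  have h1 : ‖y' t + c • y t‖ ^ 2
      = ‖y' t‖ ^ 2 + 2 * c * inner ℝ (y t) (y' t) + c ^ 2 * ‖y t‖ ^ 2 := by
    rw [norm_add_sq_real, real_inner_smul_right, norm_smul, mul_pow, Real.norm_eq_abs, sq_abs,
      real_inner_comm]
    ring
  have h2 : inner ℝ (y' t + c • y t) (-(b • y' t + μ • y t) + c • y' t)
      = (c - b) * ‖y' t‖ ^ 2 + (c * (c - b) - μ) * inner ℝ (y t) (y' t) - c * μ * ‖y t‖ ^ 2 := by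
    simp only [inner_add_left, inner_add_right, inner_neg_right, real_inner_smul_left,
      real_inner_smul_right, real_inner_self_eq_norm_sq, real_inner_comm (y t) (y' t)]
    ring
  have hp : 0 ≤ b - 2 * δ := by linarith
  rcases hc with rfl | rfl
  · have := mul_nonneg hp (sq_nonneg ‖y' t + c • y t‖)
    rw [h1] at this ⊢
    rw [h2]
    linarith
  · have := mul_nonneg (mul_nonneg hp hq) (sq_nonneg ‖y t‖)
    rw [h1, h2]
    linarith

theorem norm_add_sq_le_two_mul (x y : E) : ‖x + y‖ ^ 2 ≤ 2 * ‖x‖ ^ 2 + 2 * ‖y‖ ^ 2 := by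
  have := parallelogram_law_with_norm ℝ x y
  nlinarith [sq_nonneg ‖x - y‖]

theorem norm_smul_sq (c : ℝ) (x : E) : ‖c • x‖ ^ 2 = c ^ 2 * ‖x‖ ^ 2 := by
  rw [norm_smul, mul_pow, Real.norm_eq_abs, sq_abs]

/-- Exponential decay of the energy of a damped oscillator, with a constant that depends neither
on the parameters of the oscillator nor on the rate. -/
theorem energy_le {b μ δ : ℝ} (hδ : 0 < δ) (hδb : 2 * δ ≤ b) (hδμ : δ * b ≤ μ) {y y' : ℝ → E}
    (hy : ∀ t, 0 ≤ t → HasDerivWithinAt y (y' t) (Ici 0) t)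
    (hy' : ∀ t, 0 ≤ t → HasDerivWithinAt y' (-(b • y' t + μ • y t)) (Ici 0) t)
    {t : ℝ} (ht : 0 ≤ t) :
    ‖y' t‖ ^ 2 + μ * ‖y t‖ ^ 2 ≤
      48 * Real.exp (-2 * δ * t) * (‖y' 0‖ ^ 2 + μ * ‖y 0‖ ^ 2) := by
  set q := μ - b * δ + δ ^ 2 with hq_def
  have hb : 0 < b := by linarith
  have hδq : δ ^ 2 ≤ q := by linarith
  have hqμ : q ≤ μ := by nlinarith
  have hδμ' : 2 * δ ^ 2 ≤ μ := by nlinarith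
  have hq : 0 ≤ q := (sq_nonneg δ).trans hδq
  have hμ : 0 < μ := (mul_pos hδ hb).trans_le hδμ
  -- the value at time `t` of a nonincreasing function is bounded by its value at `0`
  have hdecay : ∀ c, c = δ ∨ c = b - δ →
      ‖y' t + c • y t‖ ^ 2 + q * ‖y t‖ ^ 2 ≤
        Real.exp (-2 * δ * t) * (‖y' 0 + c • y 0‖ ^ 2 + q * ‖y 0‖ ^ 2) := by
    intro c hc
    have h := antitoneOn_energy hδb hq hc hy hy' self_mem_Ici ht ht
    simp only [mul_zero, Real.exp_zero, one_mul] at h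
    have h' := mul_le_mul_of_nonneg_left h (Real.exp_pos (-2 * δ * t)).le
    rwa [← mul_assoc, ← Real.exp_add, show -2 * δ * t + 2 * δ * t = 0 by ring, Real.exp_zero,
      one_mul] at h'
  have hF := hdecay δ (Or.inl rfl)
  have hH := hdecay (b - δ) (Or.inr rfl)
  set e := Real.exp (-2 * δ * t)
  have he : 0 < e := Real.exp_pos _
  have hX := sq_nonneg ‖y t‖
  have hX0 := sq_nonneg ‖y 0‖
  have hY0 := sq_nonneg ‖y' 0‖
  have hF0 : ‖y' 0 + δ • y 0‖ ^ 2 + q * ‖y 0‖ ^ 2 ≤ 2 * (‖y' 0‖ ^ 2 + μ * ‖y 0‖ ^ 2) := by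
    have h := norm_add_sq_le_two_mul (y' 0) (δ • y 0)
    rw [norm_smul_sq] at h
    nlinarith
  have hF' : ‖y' t + δ • y t‖ ^ 2 + q * ‖y t‖ ^ 2 ≤
      2 * (e * (‖y' 0‖ ^ 2 + μ * ‖y 0‖ ^ 2)) := by
    have := mul_le_mul_of_nonneg_left hF0 he.le
    linarith
  have hE0 : 0 ≤ e * (‖y' 0‖ ^ 2 + μ * ‖y 0‖ ^ 2) := by positivity
  have hY : ‖y' t‖ ^ 2 ≤ 4 * (e * (‖y' 0‖ ^ 2 + μ * ‖y 0‖ ^ 2)) := by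
    have h := norm_add_sq_le_two_mul (y' t + δ • y t) (-(δ • y t))
    rw [add_neg_cancel_right, norm_neg, norm_smul_sq] at h
    have := mul_le_mul_of_nonneg_right hδq hX
    linarith
  have hYX : μ * ‖y t‖ ^ 2 ≤ 44 * (e * (‖y' 0‖ ^ 2 + μ * ‖y 0‖ ^ 2)) := by
    by_cases hcase : μ ≤ 16 * q
    · have := mul_le_mul_of_nonneg_right hcase hX
      have := sq_nonneg ‖y' t + δ • y t‖
      linarith
    · -- strong damping: `μ ≤ b²` and `δ ≤ b / 4`
      push Not at hcase
      have hμb : μ ≤ b ^ 2 := by nlinarith [sq_nonneg (b / 2 - δ)]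
      have hδ4 : 4 * δ ≤ b := by
        by_contra! h
        nlinarith
      set ε := μ / b ^ 2 with hε_def
      have hε0 : 0 ≤ ε := by positivity
      have hε1 : ε ≤ 1 := div_le_one_of_le₀ hμb (sq_nonneg b)
      have hεb : ε * b ^ 2 = μ := div_mul_cancel₀ _ (by positivity)
      have h1 : (b - 2 * δ) ^ 2 * ‖y t‖ ^ 2 ≤
          2 * ‖y' t + (b - δ) • y t‖ ^ 2 + 2 * ‖y' t + δ • y t‖ ^ 2 := by
        have h := norm_add_sq_le_two_mul (y' t + (b - δ) • y t) (-(y' t + δ • y t))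
        rwa [norm_neg, show y' t + (b - δ) • y t + -(y' t + δ • y t) = (b - 2 * δ) • y t by module,
          norm_smul_sq] at h
      have h2 : μ ≤ 4 * (ε * (b - 2 * δ) ^ 2) := by
        have : b ^ 2 ≤ 4 * (b - 2 * δ) ^ 2 := by nlinarith
        have := mul_le_mul_of_nonneg_left this hε0
        linarith
      have h3 : ε * (‖y' 0 + (b - δ) • y 0‖ ^ 2 + q * ‖y 0‖ ^ 2) ≤
          2 * ‖y' 0‖ ^ 2 + 3 * (μ * ‖y 0‖ ^ 2) := by
        have h := norm_add_sq_le_two_mul (y' 0) ((b - δ) • y 0)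
        rw [norm_smul_sq] at h
        have hbδ : (b - δ) ^ 2 ≤ b ^ 2 := by nlinarith
        have h4 := mul_le_mul_of_nonneg_left h hε0
        have h5 := mul_le_mul_of_nonneg_right
          (mul_le_mul_of_nonneg_left hbδ hε0) hX0
        rw [hεb] at h5
        have h6 := mul_le_mul_of_nonneg_right hε1 hY0
        have h7 := mul_le_mul_of_nonneg_right (mul_le_mul hε1 hqμ hq zero_le_one) hX0
        linarith
      have h8 := mul_le_mul_of_nonneg_left h1 hε0
      have h9 := mul_le_mul_of_nonneg_left hH hε0
      have h10 := mul_le_mul_of_nonneg_left h3 he.le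
      have h11 := mul_le_mul_of_nonneg_right h2 hX
      have h12 := mul_le_mul_of_nonneg_right hε1 (sq_nonneg ‖y' t + δ • y t‖)
      have h13 : 0 ≤ ε * (q * ‖y t‖ ^ 2) := by positivity
      have h14 : 0 ≤ q * ‖y t‖ ^ 2 := by positivity
      have h15 : 0 ≤ e * ‖y' 0‖ ^ 2 := by positivity
      linarith
  linarith

end Oscillator

/-! ### From weak to strong derivatives -/

/-- A function on `[0, ∞)` with values in a Hilbert space that has a weak derivative which is
continuous in norm is differentiable in norm. -/
theorem hasDerivWithinAt_Ici_of_inner {E : Type*} [NormedAddCommGroup E] [InnerProductSpace ℝ E]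
    [CompleteSpace E] {w h : ℝ → E} (hh : ContinuousOn h (Ici 0))
    (hw : ∀ v : E, ∀ t, 0 ≤ t →
      HasDerivWithinAt (fun s => inner ℝ (w s) v) (inner ℝ (h t) v) (Ici 0) t)
    {t : ℝ} (ht : 0 ≤ t) : HasDerivWithinAt w (h t) (Ici 0) t := by
  have hcont : Continuous fun s : ℝ => h (max s 0) :=
    hh.comp_continuous (by fun_prop) fun s => le_max_right s 0
  set W : ℝ → E := fun s => ∫ r in (0 : ℝ)..s, h (max r 0)
  have hW : ∀ s, 0 ≤ s → HasDerivWithinAt W (h s) (Ici 0) s := fun s hs => by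
    simpa [max_eq_left hs] using (hcont.integral_hasStrictDerivAt 0 s).hasDerivAt.hasDerivWithinAt
  have hconst : ∀ s, 0 ≤ s → w s = w 0 + W s := by
    intro s hs
    refine ext_inner_right ℝ fun v => ?_
    have hd : ∀ r ∈ Ici (0 : ℝ),
        HasDerivWithinAt (fun r => inner ℝ (w r) v - inner ℝ (W r) v) 0 (Ici 0) r := by
      intro r hr
      refine ((hw v r hr).fun_sub
        ((hW r hr).inner ℝ (hasDerivWithinAt_const r (Ici 0) v))).congr_deriv ?_
      simp
    have h0 := (convex_Ici (0 : ℝ)).is_const_of_fderivWithin_eq_zero (𝕜 := ℝ)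
      (fun r hr => (hd r hr).differentiableWithinAt)
      (fun r hr => by
        simpa using (hd r hr).hasFDerivWithinAt.fderivWithin (uniqueDiffOn_Ici 0 r hr))
      (show s ∈ Ici (0 : ℝ) from hs) self_mem_Ici
    have hW0 : W 0 = 0 := intervalIntegral.integral_same
    simp only [hW0, inner_zero_left, sub_zero] at h0
    rw [inner_add_left]
    linarith
  exact ((hW t ht).const_add (w 0)).congr (fun s hs => hconst s hs) (hconst t ht)

/-! ### Projection of a solution onto an eigenspace -/

namespace DampedWave

variable {d : ℕ} {Ω : Set (EuclideanSpace ℝ (Fin d))}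

theorem hasDerivWithinAt_timeDeriv {n : ℕ} {u : ℝ → L2 Ω} (hu : ContDiffOn ℝ n u (Ici 0)) {m : ℕ}
    (hm : m < n) {t : ℝ} (ht : 0 ≤ t) :
    HasDerivWithinAt (timeDeriv m u) (timeDeriv (m + 1) u t) (Ici 0) t := by
  have h := hu.differentiableOn_iteratedDerivWithin (m := m) (by exact_mod_cast hm)
    (uniqueDiffOn_Ici 0) t ht
  have h' := h.hasDerivWithinAt
  rwa [← iteratedDerivWithin_succ] at h'

theorem hasDerivWithinAt_starProjection_timeDeriv {n : ℕ} {u : ℝ → L2 Ω}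
    (hu : ContDiffOn ℝ n u (Ici 0)) (μ : ℝ) {m : ℕ} (hm : m < n) {t : ℝ} (ht : 0 ≤ t) :
    HasDerivWithinAt (fun s => (eigenspace Ω μ).starProjection (timeDeriv m u s))
      ((eigenspace Ω μ).starProjection (timeDeriv (m + 1) u t)) (Ici 0) t :=
  (eigenspace Ω μ).starProjection.hasFDerivAt.comp_hasDerivWithinAt t
    (hasDerivWithinAt_timeDeriv hu hm ht)

/-- The projection `y = P_μ u` of a solution satisfies `y'' = -((α + β μ) y' + μ y)`. -/
theorem IsSolution.hasDerivWithinAt_starProjection {α β : ℝ} {u₀ u₁ : L2 Ω} {u : ℝ → L2 Ω}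
    (hu : IsSolution Ω α β u₀ u₁ u) (μ : ℝ) {t : ℝ} (ht : 0 ≤ t) :
    HasDerivWithinAt (fun s => (eigenspace Ω μ).starProjection (timeDeriv 1 u s))
      (-((α + β * μ) • (eigenspace Ω μ).starProjection (timeDeriv 1 u t) +
        μ • (eigenspace Ω μ).starProjection (timeDeriv 0 u t))) (Ici 0) t := by
  obtain ⟨G, -, hG, heq⟩ := hu.equation
  set P := (eigenspace Ω μ).starProjection
  have hC1 : ContDiffOn ℝ (1 : ℕ) u (Ici 0) := by simpa using hu.contDiffOn
  have hd0 : ∀ s, 0 ≤ s → HasDerivWithinAt (timeDeriv 0 u) (timeDeriv 1 u s) (Ici 0) s :=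
    fun s hs => hasDerivWithinAt_timeDeriv hC1 zero_lt_one hs
  have hc0 : ContinuousOn (timeDeriv 0 u) (Ici 0) := fun s hs => (hd0 s hs).continuousWithinAt
  have hc1 : ContinuousOn (timeDeriv 1 u) (Ici 0) :=
    hC1.continuousOn_iteratedDerivWithin (by norm_num) (uniqueDiffOn_Ici 0)
  have hu0 : ∀ s, timeDeriv 0 u s = u s := fun s => by simp [timeDeriv]
  refine hasDerivWithinAt_Ici_of_inner
    (h := fun s => -((α + β * μ) • P (timeDeriv 1 u s) + μ • P (timeDeriv 0 u s)))
    (by fun_prop) (fun v s hs => ?_) ht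
  -- the equation is tested with the eigenfunction `P v`
  obtain ⟨g, hg, hgv⟩ : IsDirichletLaplacian Ω (P v) (μ • P v) :=
    Submodule.starProjection_apply_mem (eigenspace Ω μ) v
  have hinner : ∀ r, 0 ≤ r → inner ℝ (G r) g = μ * inner ℝ (timeDeriv 0 u r) (P v) := by
    intro r hr
    rw [real_inner_comm, hgv _ (hG r hr), real_inner_smul_left, real_inner_comm, hu0]
  have hsymm : ∀ x : L2 Ω, inner ℝ (P x) v = inner ℝ x (P v) := fun x =>
    Submodule.inner_starProjection_left_eq_right (eigenspace Ω μ) x v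
  have h1 := heq (P v, g) hg s hs
  have h2 := ((hd0 s hs).inner ℝ (hasDerivWithinAt_const s (Ici 0) (P v))).const_mul (β * μ)
  have h3 := h1.sub h2
  simp only [inner_zero_right, zero_add] at h3
  rw [hinner s hs] at h3
  have heqOn : ∀ r ∈ Ici (0 : ℝ), inner ℝ (P (timeDeriv 1 u r)) v =
      inner ℝ (timeDeriv 1 u r) (P v) + β * inner ℝ (G r) g
        - β * μ * inner ℝ (timeDeriv 0 u r) (P v) := by
    intro r hr
    rw [hinner r hr, hsymm]
    ring
  refine (h3.congr heqOn (heqOn s hs)).congr_deriv ?_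
  rw [inner_neg_left, inner_add_left, real_inner_smul_left, real_inner_smul_left, hsymm, hsymm]
  ring

/-- The projection of each time derivative of a solution satisfies the equation of
`DampedWave.IsSolution.hasDerivWithinAt_starProjection`, which can be differentiated as often as
`u` can. -/
theorem IsSolution.hasDerivWithinAt_starProjection_succ {α β : ℝ} {u₀ u₁ : L2 Ω} {u : ℝ → L2 Ω}
    (hu : IsSolution Ω α β u₀ u₁ u) (μ : ℝ) {n : ℕ} (hn : ContDiffOn ℝ n u (Ici 0)) (m : ℕ)
    (hm : m < n) {t : ℝ} (ht : 0 ≤ t) :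
    HasDerivWithinAt (fun s => (eigenspace Ω μ).starProjection (timeDeriv (m + 1) u s))
      (-((α + β * μ) • (eigenspace Ω μ).starProjection (timeDeriv (m + 1) u t) +
        μ • (eigenspace Ω μ).starProjection (timeDeriv m u t))) (Ici 0) t := by
  induction m generalizing t with
  | zero => exact hu.hasDerivWithinAt_starProjection μ ht
  | succ m ih =>
    have heq : ∀ s ∈ Ici (0 : ℝ), (eigenspace Ω μ).starProjection (timeDeriv (m + 1 + 1) u s) =
        -((α + β * μ) • (eigenspace Ω μ).starProjection (timeDeriv (m + 1) u s) +
          μ • (eigenspace Ω μ).starProjection (timeDeriv m u s)) := fun s hs =>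
      (uniqueDiffOn_Ici 0 s hs).eq_deriv _
        (hasDerivWithinAt_starProjection_timeDeriv hn μ hm hs) (ih (by omega) hs)
    have h1 := hasDerivWithinAt_starProjection_timeDeriv hn μ (show m < n by omega) ht
    have h2 := hasDerivWithinAt_starProjection_timeDeriv hn μ hm ht
    exact (((h2.const_smul (α + β * μ)).add (h1.const_smul μ)).neg).congr heq (heq t ht)

/-! ### Decay of the energy -/

/-- The bound `δ ≤ λ₁ / (α + β λ₁)` passes on to the larger eigenvalues, since `μ / (α + β μ)` does
not decrease in `μ`. -/
theorem mul_damping_le_of_le {α β lam₁ μ δ : ℝ} (hα : 0 ≤ α) (hlam : 0 < lam₁) (hμ : lam₁ ≤ μ)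
    (hδ : 0 < δ) (h : δ * (α + β * lam₁) ≤ lam₁) : δ * (α + β * μ) ≤ μ := by
  have h1 : 0 ≤ 1 - δ * β := by
    by_contra! hneg
    nlinarith [mul_nonneg hδ.le hα]
  nlinarith

/-- The decay of the full energy (here without the factor `1 / 2`) for all admissible `δ`, the
endpoint `δ = λ₁ / (α + β λ₁)` included: the sum over the eigenvalues of `Oscillator.energy_le`. -/
theorem IsSolution.energy_le {α β lam₁ : ℝ} (hα : 0 ≤ α) (hβ : 0 ≤ β) (hαβ : 0 < α + β)
    (hlam : IsLeast (eigenvalues Ω) lam₁) {u₀ u₁ : L2 Ω} {u : ℝ → L2 Ω}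
    (hu : IsSolution Ω α β u₀ u₁ u) (j : ℝ) {k : ℕ} (hk : 1 ≤ k)
    (hn : ContDiffOn ℝ k u (Ici 0)) {δ : ℝ} (hδ : 0 < δ)
    (hδle : δ ≤ min ((α + β * lam₁) / 2) (lam₁ / (α + β * lam₁))) {t : ℝ} (ht : 0 ≤ t) :
    normSq Ω (2 * j - 1) (timeDeriv k u t) + normSq Ω (2 * j) (timeDeriv (k - 1) u t) ≤
      ENNReal.ofReal (48 * Real.exp (-2 * δ * t)) *
        (normSq Ω (2 * j - 1) (timeDeriv k u 0) + normSq Ω (2 * j) (timeDeriv (k - 1) u 0)) := by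
  obtain ⟨k, rfl⟩ : ∃ m, k = m + 1 := ⟨k - 1, by omega⟩
  have hl : 0 < lam₁ := hlam.1.1
  have hb : 0 < α + β * lam₁ := by
    rcases hα.lt_or_eq with h | h
    · positivity
    · have : 0 < β := by linarith
      positivity
  rw [add_tsub_cancel_right]
  unfold normSq
  rw [← ENNReal.tsum_add, ← ENNReal.tsum_add, ← ENNReal.tsum_mul_left]
  refine ENNReal.tsum_le_tsum fun ⟨μ, hμ⟩ => ?_
  have hμ0 : 0 < μ := hμ.1
  have hlμ : lam₁ ≤ μ := hlam.2 hμ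
  have h := Oscillator.energy_le (b := α + β * μ) (μ := μ) hδ
    (by nlinarith [hδle.trans (min_le_left _ _)])
    (mul_damping_le_of_le hα hl hlμ hδ ((le_div_iff₀ hb).1 (hδle.trans (min_le_right _ _))))
    (fun s hs => hasDerivWithinAt_starProjection_timeDeriv hn μ k.lt_succ_self hs)
    (fun s hs => hu.hasDerivWithinAt_starProjection_succ μ hn k k.lt_succ_self hs) ht
  have hpow : μ ^ (2 * j) = μ ^ (2 * j - 1) * μ := by
    rw [Real.rpow_sub_one hμ0.ne', div_mul_cancel₀ _ hμ0.ne']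
  have hpos : 0 ≤ μ ^ (2 * j - 1) := by positivity
  dsimp only
  rw [← ENNReal.ofReal_add (by positivity) (by positivity),
    ← ENNReal.ofReal_add (by positivity) (by positivity), ← ENNReal.ofReal_mul (by positivity)]
  refine ENNReal.ofReal_le_ofReal ?_
  rw [hpow]
  have := mul_le_mul_of_nonneg_left h hpos
  linarith

end DampedWave

theorem mainTheorem6 (α β lam₁ : ℝ) (hα : 0 ≤ α) (hβ : 0 ≤ β) (hαβ : 0 < α + β) :
    ∃ C : ℝ, 0 < C ∧
      ∀ (d : ℕ) (Ω : Set (EuclideanSpace ℝ (Fin d))),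
        IsOpen Ω → IsConnected Ω → Bornology.IsBounded Ω →
        IsLeast (DampedWave.eigenvalues Ω) lam₁ →
      ∀ (j : ℝ), 1 / 2 ≤ j →
      ∀ (u₀ u₁ : DampedWave.L2 Ω),
        u₀ ∈ DampedWave.domPow Ω j → u₁ ∈ DampedWave.domPow Ω (j - 1 / 2) →
      ∀ (u : ℝ → DampedWave.L2 Ω), DampedWave.IsSolution Ω α β u₀ u₁ u →
      ∀ (k : ℕ), 1 ≤ k → ContDiffOn ℝ k u (Set.Ici 0) →
      ∀ (δ : ℝ), 0 < δ → δ ≤ min ((α + β * lam₁) / 2) (lam₁ / (α + β * lam₁)) →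
        ((δ < min ((α + β * lam₁) / 2) (lam₁ / (α + β * lam₁)) ∨ δ = (α + β * lam₁) / 2) →
          ∀ t : ℝ, 0 ≤ t →
            DampedWave.energy j k u t ≤
              ENNReal.ofReal (C * Real.exp (-2 * δ * t)) * DampedWave.energy j k u 0) ∧
        (δ = lam₁ / (α + β * lam₁) →
          ∀ t : ℝ, 0 ≤ t →
            DampedWave.normSq Ω (2 * j - 1) (DampedWave.timeDeriv k u t) ≤
              ENNReal.ofReal (C * Real.exp (-2 * δ * t)) * DampedWave.energy j k u 0) := by
  refine ⟨96, by norm_num, ?_⟩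
  intro d Ω _ _ _ hlam j _ u₀ u₁ _ _ u hu k hk hn δ hδ hδle
  have h := fun (t : ℝ) (ht : 0 ≤ t) => hu.energy_le hα hβ hαβ hlam j hk hn hδ hδle ht
  refine ⟨fun _ t ht => ?_, fun _ t ht => ?_⟩
  · calc DampedWave.energy j k u t
        ≤ ENNReal.ofReal (48 * Real.exp (-2 * δ * t)) * DampedWave.energy j k u 0 := by
          unfold DampedWave.energy
          rw [← mul_div_assoc]
          exact ENNReal.div_le_div_right (h t ht) 2
      _ ≤ ENNReal.ofReal (96 * Real.exp (-2 * δ * t)) * DampedWave.energy j k u 0 := by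
          gcongr
          norm_num
  · -- the factor `1 / 2` in the energy at time `0` doubles the constant
    refine (le_self_add.trans (h t ht)).trans_eq ?_
    unfold DampedWave.energy
    rw [show 96 * Real.exp (-2 * δ * t) = 48 * Real.exp (-2 * δ * t) * 2 by ring,
      ENNReal.ofReal_mul (p := 48 * Real.exp (-2 * δ * t)) (by positivity),
      ENNReal.ofReal_ofNat, mul_assoc (ENNReal.ofReal _),
      ENNReal.mul_div_cancel (by norm_num) (by norm_num)]
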